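/- All vector spaces are over $\mathbb{C}$. Let $\lambda$ be any partition of $m$, with column lengths $\lambda'_1\ge\lambda'_2\ge\cdots$, and let $\mathcal{T}_\lambda$ be the set of fillings of the Young diagram of $\lambda$ using each of $1,\dots,m$ exactly once; $S_m$ acts on $\mathcal{T}_\lambda$ by permuting entries. For $t\in\mathcal{T}_\lambda$ let $C_t\le S_m$ be the column stabilizer, $\{t\}$ the row tabloid of $t$ (the class of $t$ under having the same entries in each row), and $\varepsilon_t=\sum_{\beta\in C_t}\operatorname{sgn}(\beta)\{\beta t\}$. The Specht module $S^\lambda$ is the span of all $\varepsilon_t$ in the permutation module on row tabloids. Let $\tilde M^\lambda$ be the vector space generated by symbols $[t]$, $t\in\mathcal{T}_\lambda$ (column tabloids), modulo the relations $[t]=\operatorname{sgn}(\beta)[\beta t]$ for $\beta\in C_t$, with $S_m$-action $\sigma[t]=[\sigma t]$. For $1\le c\le\lambda_1-1$ let $h_c:\tilde M^\lambda\to\tilde M^\lambda$ be the (well-defined) linear map $$h_c([t])=\sum_{\ell=1}^{\lambda'_{c+1}}\Bigl([t]-\sum_{i=1}^{\lambda'_c}[t_{i,\ell}]\Bigr),$$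 where $t_{i,\ell}$ is obtained from $t$ by exchanging the $i$-th entry of column $c$ with the $\ell$-th entry of column $c+1$. Let $\tilde H^\lambda$ be the span of the elements $h_c([t])$ for $1\le c\le\lambda_1-1$ and all $t\in\mathcal{T}_\lambda$ whose columns increase from top to bottom. Theorem. $\tilde H^\lambda$ is $S_m$-stable, and there is an isomorphism of $S_m$-representations $$\tilde M^\lambda/\tilde H^\lambda\;\cong\;S^\lambda$$ sending the class of $[t]$ to $\varepsilon_t$ for every $t\in\mathcal{T}_\lambda$. -/

import Mathlib

namespace SpechtPresentation

/-- The boxes of a Young diagram: the box `x` lies in row `x.1.1` and column `x.1.2`,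
rows and columns being counted from `0`. -/
abbrev Cell (lam : YoungDiagram) : Type := {x : ℕ × ℕ // x ∈ lam.cells}

/-- The Young tableaux of shape `lam` in which each of the `m` letters appears exactly once. -/
abbrev Tableau (lam : YoungDiagram) (m : ℕ) : Type := Cell lam ≃ Fin m

variable {lam : YoungDiagram} {m : ℕ}

/-- The symmetric group acts on tableaux by permuting the entries. -/
instance tableauAction : MulAction (Equiv.Perm (Fin m)) (Tableau lam m) where
  smul s t := t.trans s
  one_smul _ := rfl
  mul_smul _ _ _ := rfl

theorem smul_tableau_apply (s : Equiv.Perm (Fin m)) (t : Tableau lam m) (x : Cell lam) :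
    (s • t) x = s (t x) := rfl

theorem smul_tableau_symm (s : Equiv.Perm (Fin m)) (t : Tableau lam m) (k : Fin m) :
    (s • t).symm k = t.symm (s⁻¹ k) := rfl

/-- The permutation representation over `ℂ` on the vector space with basis `X`. -/
noncomputable def permRep (m : ℕ) (X : Type) [MulAction (Equiv.Perm (Fin m)) X] :
    Representation ℂ (Equiv.Perm (Fin m)) (X →₀ ℂ) where
  toFun s := Finsupp.lmapDomain ℂ ℂ (s • ·)
  map_one' := by ext; simp
  map_mul' s u := by ext; simp [mul_smul]

theorem permRep_single {X : Type} [MulAction (Equiv.Perm (Fin m)) X]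
    (s : Equiv.Perm (Fin m)) (x : X) (a : ℂ) :
    permRep m X s (Finsupp.single x a) = Finsupp.single (s • x) a := by
  simp [permRep]

/-- The column stabilizer `C_t`: the permutations of the letters that send each letter to a
letter of the same column of `t`. -/
def colStabilizer (t : Tableau lam m) : Subgroup (Equiv.Perm (Fin m)) where
  carrier := {b | ∀ k : Fin m, (t.symm (b k)).1.2 = (t.symm k).1.2}
  mul_mem' := by
    intro a b ha hb k
    exact (ha (b k)).trans (hb k)
  one_mem' := fun _ => rfl
  inv_mem' := by
    intro a ha k
    have h := ha (a⁻¹ k)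
    have e : a (a⁻¹ k) = k := a.apply_symm_apply k
    rw [e] at h
    exact h.symm

theorem mem_colStabilizer (t : Tableau lam m) (b : Equiv.Perm (Fin m)) :
    b ∈ colStabilizer t ↔ ∀ k : Fin m, (t.symm (b k)).1.2 = (t.symm k).1.2 := Iff.rfl

/-! ### Row tabloids, polytabloids and the Specht module -/

/-- Two tableaux are row equivalent if they have the same entries in each row. -/
def rowSetoid (lam : YoungDiagram) (m : ℕ) : Setoid (Tableau lam m) where
  r s t := ∀ k : Fin m, (s.symm k).1.1 = (t.symm k).1.1
  iseqv :=
    { refl := fun _ _ => rfl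
      symm := fun h k => (h k).symm
      trans := fun h₁ h₂ k => (h₁ k).trans (h₂ k) }

/-- Row tabloids. -/
def RowTabloid (lam : YoungDiagram) (m : ℕ) : Type := Quotient (rowSetoid lam m)

/-- The row tabloid `{t}` of a tableau `t`. -/
def rowTabloid (t : Tableau lam m) : RowTabloid lam m := Quotient.mk (rowSetoid lam m) t

/-- The action `s {t} = {s t}` on row tabloids. -/
instance rowTabloidAction : MulAction (Equiv.Perm (Fin m)) (RowTabloid lam m) where
  smul s := Quotient.map (s • ·) (fun _ _ h k => h (s⁻¹ k))
  one_smul := by rintro ⟨t⟩; rfl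
  mul_smul := by rintro s u ⟨t⟩; rfl

theorem smul_rowTabloid (s : Equiv.Perm (Fin m)) (t : Tableau lam m) :
    s • rowTabloid t = rowTabloid (s • t) := rfl

open Classical in
/-- The polytabloid `ε_t = ∑_{b ∈ C_t} sgn(b) {b t}`. -/
noncomputable def polytabloid (t : Tableau lam m) : RowTabloid lam m →₀ ℂ :=
  ∑ b : Equiv.Perm (Fin m) with b ∈ colStabilizer t,
    ((Equiv.Perm.sign b : ℤ) : ℂ) • Finsupp.single (rowTabloid (b • t)) 1

theorem conj_mem_colStabilizer (s : Equiv.Perm (Fin m)) (t : Tableau lam m)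
    (b : Equiv.Perm (Fin m)) :
    s * b * s⁻¹ ∈ colStabilizer (s • t) ↔ b ∈ colStabilizer t := by
  have e : ∀ k, s⁻¹ (s k) = k := s.symm_apply_apply
  simp only [mem_colStabilizer, smul_tableau_symm, Equiv.Perm.mul_apply, e]
  refine ⟨fun h k => ?_, fun h k => h (s⁻¹ k)⟩
  have := h (s k)
  rwa [e] at this

theorem permRep_polytabloid (s : Equiv.Perm (Fin m)) (t : Tableau lam m) :
    permRep m (RowTabloid lam m) s (polytabloid t) = polytabloid (s • t) := by
  classical
  unfold polytabloid
  rw [map_sum]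
  refine Finset.sum_bij' (fun b _ => s * b * s⁻¹) (fun b _ => s⁻¹ * b * s) ?_ ?_ ?_ ?_ ?_
  · intro b hb
    simpa [conj_mem_colStabilizer] using hb
  · intro b hb
    simp only [Finset.mem_filter, Finset.mem_univ, true_and] at hb ⊢
    rw [← conj_mem_colStabilizer s]
    simpa [mul_assoc] using hb
  · intro b _
    simp [mul_assoc]
  · intro b _
    simp [mul_assoc]
  · intro b _
    rw [map_smul, permRep_single, smul_rowTabloid, smul_smul, smul_smul]
    have h : Equiv.Perm.sign (s * b * s⁻¹) = Equiv.Perm.sign b := by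
      rw [map_mul, map_mul, map_inv, mul_comm, inv_mul_cancel_left]
    rw [h]
    simp

/-- The Specht module `S^lam`, as a subspace of the space of row tabloids: the span of all
polytabloids. -/
noncomputable def spechtModule (lam : YoungDiagram) (m : ℕ) :
    Submodule ℂ (RowTabloid lam m →₀ ℂ) :=
  Submodule.span ℂ (Set.range (polytabloid (lam := lam) (m := m)))

theorem spechtModule_le_comap (s : Equiv.Perm (Fin m)) :
    spechtModule lam m ≤ (spechtModule lam m).comap (permRep m (RowTabloid lam m) s) := by
  refine Submodule.span_le.2 ?_
  rintro _ ⟨t, rfl⟩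
  show permRep m (RowTabloid lam m) s (polytabloid t) ∈ spechtModule lam m
  rw [permRep_polytabloid]
  exact Submodule.subset_span ⟨_, rfl⟩

/-- The Specht module as a representation of the symmetric group. -/
noncomputable def spechtRep (lam : YoungDiagram) (m : ℕ) :
    Representation ℂ (Equiv.Perm (Fin m)) (spechtModule lam m) :=
  (permRep m (RowTabloid lam m)).subrepresentation (spechtModule lam m) spechtModule_le_comap

/-! ### Column tabloids -/

/-- The antisymmetry relations: the span of all `t - sgn(b) (b t)` with `b ∈ C_t`. -/
noncomputable def antisymmetry (lam : YoungDiagram) (m : ℕ) :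
    Submodule ℂ (Tableau lam m →₀ ℂ) :=
  Submodule.span ℂ {v | ∃ t : Tableau lam m, ∃ b ∈ colStabilizer t,
    v = Finsupp.single t 1 - ((Equiv.Perm.sign b : ℤ) : ℂ) • Finsupp.single (b • t) 1}

theorem antisymmetry_le_comap (s : Equiv.Perm (Fin m)) :
    antisymmetry lam m ≤ (antisymmetry lam m).comap (permRep m (Tableau lam m) s) := by
  refine Submodule.span_le.2 ?_
  rintro _ ⟨t, b, hb, rfl⟩
  refine Submodule.subset_span ⟨s • t, s * b * s⁻¹, (conj_mem_colStabilizer s t b).2 hb, ?_⟩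
  have h : Equiv.Perm.sign (s * b * s⁻¹) = Equiv.Perm.sign b := by
    rw [map_mul, map_mul, map_inv, mul_comm, inv_mul_cancel_left]
  rw [h, map_sub, map_smul, permRep_single, permRep_single, smul_smul, smul_smul]
  simp

/-- The space of column tabloids `M̃^lam`: formal combinations of tableaux modulo the
antisymmetry relations. -/
abbrev ColumnModule (lam : YoungDiagram) (m : ℕ) : Type :=
  (Tableau lam m →₀ ℂ) ⧸ antisymmetry lam m

/-- `M̃^lam` as a representation of the symmetric group; the action is `s [t] = [s t]`. -/
noncomputable def columnRep (lam : YoungDiagram) (m : ℕ) :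
    Representation ℂ (Equiv.Perm (Fin m)) (ColumnModule lam m) :=
  (permRep m (Tableau lam m)).quotient (antisymmetry lam m) antisymmetry_le_comap

/-- The column tabloid `[t]`. -/
noncomputable def colTabloid (t : Tableau lam m) : ColumnModule lam m :=
  (antisymmetry lam m).mkQ (Finsupp.single t 1)

theorem columnRep_colTabloid (s : Equiv.Perm (Fin m)) (t : Tableau lam m) :
    columnRep lam m s (colTabloid t) = colTabloid (s • t) := by
  show (antisymmetry lam m).mkQ (permRep m (Tableau lam m) s (Finsupp.single t 1)) = _
  rw [permRep_single]
  rfl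

theorem colTabloid_smul (t : Tableau lam m) (b : Equiv.Perm (Fin m))
    (hb : b ∈ colStabilizer t) :
    colTabloid t = ((Equiv.Perm.sign b : ℤ) : ℂ) • colTabloid (b • t) := by
  unfold colTabloid
  rw [← map_smul, ← sub_eq_zero, ← map_sub, Submodule.mkQ_apply,
    Submodule.Quotient.mk_eq_zero]
  exact Submodule.subset_span ⟨t, b, hb, rfl⟩

/-! ### The relations -/

/-- The boxes of column `c`. -/
def colCells (lam : YoungDiagram) (c : ℕ) : Finset (Cell lam) :=
  Finset.univ.filter fun x => x.1.2 = c

/-- The tableau obtained from `t` by exchanging the entries of the boxes `x` and `y`. -/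
def exchange (t : Tableau lam m) (x y : Cell lam) : Tableau lam m := (Equiv.swap x y).trans t

/-- For a box `y` of column `c + 1`, the sum of the column tabloids obtained from `t` by
exchanging the entry of `y` with each of the entries of column `c`. -/
noncomputable def exchangeSum (c : ℕ) (y : Cell lam) (t : Tableau lam m) : ColumnModule lam m :=
  ∑ x ∈ colCells lam c, colTabloid (exchange t x y)

/-- The map `η` applied to the columns `c` and `c + 1` of `t`, all other columns being fixed:
the sum over the boxes `y` of column `c + 1` of the dual Garnir relations
`[t] - exchangeSum c y t`. -/
noncomputable def etaTableau (c : ℕ) (t : Tableau lam m) : ColumnModule lam m :=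
  ∑ y ∈ colCells lam (c + 1), (colTabloid t - exchangeSum c y t)

/-- Rearranging a tableau by a column preserving permutation of the boxes. -/
theorem colTabloid_rearrange (g : Equiv.Perm (Cell lam)) (hg : ∀ x, (g x).1.2 = x.1.2)
    (s : Tableau lam m) :
    colTabloid s = ((Equiv.Perm.sign g : ℤ) : ℂ) • colTabloid (g.trans s) := by
  have hb : (s.permCongr g) ∈ colStabilizer s := by
    intro k
    simp [Equiv.permCongr_apply, hg]
  have h := colTabloid_smul s _ hb
  have h2 : (s.permCongr g) • s = g.trans s := by
    ext x
    rw [smul_tableau_apply]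
    simp [Equiv.permCongr_apply]
  rw [h2, Equiv.Perm.sign_permCongr] at h
  exact h

theorem etaTableau_rearrange (c : ℕ) (g : Equiv.Perm (Cell lam))
    (hg : ∀ x, (g x).1.2 = x.1.2) (s : Tableau lam m) :
    etaTableau c s = ((Equiv.Perm.sign g : ℤ) : ℂ) • etaTableau c (g.trans s) := by
  unfold etaTableau exchangeSum
  rw [Finset.smul_sum]
  symm
  refine Finset.sum_equiv g ?_ ?_
  · intro y
    simp [colCells, hg]
  intro y _
  rw [smul_sub, ← colTabloid_rearrange g hg s, Finset.smul_sum]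
  congr 1
  refine Finset.sum_equiv g ?_ ?_
  · intro x
    simp [colCells, hg]
  intro x _
  rw [colTabloid_rearrange g hg (exchange s (g x) (g y))]
  congr 2
  ext z
  simp only [exchange, Equiv.trans_apply]
  rw [Equiv.swap_apply_apply]
  simp

theorem etaTableau_smul (c : ℕ) (t : Tableau lam m) (b : Equiv.Perm (Fin m))
    (hb : b ∈ colStabilizer t) :
    etaTableau c t = ((Equiv.Perm.sign b : ℤ) : ℂ) • etaTableau c (b • t) := by
  have h := etaTableau_rearrange c (t.symm.permCongr b) (fun x => by
    have := hb (t x)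
    simpa [Equiv.permCongr_apply] using this) t
  rw [Equiv.Perm.sign_permCongr] at h
  convert h using 3
  ext x
  rw [smul_tableau_apply]
  simp [Equiv.permCongr_apply]

/-- The linear map `h_c : M̃^lam → M̃^lam`: apply `η` to the adjacent columns `c`, `c + 1` of a
column tabloid and fix the other columns. -/
noncomputable def hMap (lam : YoungDiagram) (m : ℕ) (c : ℕ) :
    ColumnModule lam m →ₗ[ℂ] ColumnModule lam m :=
  (antisymmetry lam m).liftQ (Finsupp.linearCombination ℂ (etaTableau c)) <| by
    refine Submodule.span_le.2 ?_
    rintro _ ⟨t, b, hb, rfl⟩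
    show Finsupp.linearCombination ℂ (etaTableau c) _ = 0
    rw [map_sub, map_smul, Finsupp.linearCombination_single, Finsupp.linearCombination_single,
      one_smul, one_smul, sub_eq_zero]
    exact etaTableau_smul c t b hb

theorem hMap_colTabloid (c : ℕ) (t : Tableau lam m) :
    hMap lam m c (colTabloid t) = etaTableau c t := by
  show Finsupp.linearCombination ℂ (etaTableau c) (Finsupp.single t 1) = _
  rw [Finsupp.linearCombination_single, one_smul]

/-- A tableau has ordered columns if its entries increase going down the columns. -/
def ColumnsOrdered (t : Tableau lam m) : Prop :=
  ∀ x y : Cell lam, x.1.2 = y.1.2 → x.1.1 < y.1.1 → t x < t y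

/-- The space of relations `H̃^lam`: the span of `h_c [t]` for all column tabloids `[t]` with
ordered columns and all pairs `c`, `c + 1` of adjacent columns of `lam`. -/
noncomputable def relations (lam : YoungDiagram) (m : ℕ) : Submodule ℂ (ColumnModule lam m) :=
  Submodule.span ℂ {v | ∃ t : Tableau lam m, ColumnsOrdered t ∧
    ∃ c : ℕ, c + 1 < lam.rowLen 0 ∧ v = hMap lam m c (colTabloid t)}

/-- Every tableau can be rearranged within its columns to a tableau with ordered columns. -/
theorem exists_columnsOrdered (t : Tableau lam m) :
    ∃ b ∈ colStabilizer t, ColumnsOrdered (b • t) := by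
  classical
  obtain ⟨b, hb, hmax⟩ := Finset.exists_max_image
    (Finset.univ.filter fun b : Equiv.Perm (Fin m) => b ∈ colStabilizer t)
    (fun b => ∑ x : Cell lam, (x.1.1 : ℤ) * (((b • t) x : Fin m) : ℕ))
    ⟨1, by simp⟩
  simp only [Finset.mem_filter, Finset.mem_univ, true_and] at hb hmax
  refine ⟨b, hb, ?_⟩
  intro x y hxy hlt
  by_contra hcon
  have hne : x ≠ y := by
    rintro rfl
    exact lt_irrefl _ hlt
  have hyx : (b • t) y < (b • t) x :=
    lt_of_le_of_ne (not_lt.1 hcon) (fun h => hne ((b • t).injective h).symm)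
  set u := b • t with hu
  have hmem : Equiv.swap (u x) (u y) * b ∈ colStabilizer t := by
    intro k
    have hk := hb k
    have e1 : (t.symm (u x)).1.2 = x.1.2 := by
      have := hb (t x)
      rw [Equiv.symm_apply_apply] at this
      exact this
    have e2 : (t.symm (u y)).1.2 = y.1.2 := by
      have := hb (t y)
      rw [Equiv.symm_apply_apply] at this
      exact this
    rw [Equiv.Perm.mul_apply, ← hk]
    by_cases h1 : b k = u x
    · rw [h1, Equiv.swap_apply_left, e1, e2, hxy]
    · by_cases h2 : b k = u y
      · rw [h2, Equiv.swap_apply_right, e1, e2, hxy]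
      · rw [Equiv.swap_apply_of_ne_of_ne h1 h2]
  have hle := hmax _ hmem
  rw [mul_smul, ← hu] at hle
  have hval : ∀ z : Cell lam, (Equiv.swap (u x) (u y) • u) z = u (Equiv.swap x y z) := by
    intro z
    rw [smul_tableau_apply]
    simp only [Equiv.swap_apply_def, u.injective.eq_iff]
    split_ifs <;> rfl
  simp only [hval] at hle
  have hd : ∑ z : Cell lam, (z.1.1 : ℤ) * ((u (Equiv.swap x y z) : Fin m) : ℕ)
      - ∑ z : Cell lam, (z.1.1 : ℤ) * ((u z : Fin m) : ℕ)
      = (x.1.1 : ℤ) * ((u y : Fin m) : ℕ) - x.1.1 * ((u x : Fin m) : ℕ)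
        + ((y.1.1 : ℤ) * ((u x : Fin m) : ℕ) - y.1.1 * ((u y : Fin m) : ℕ)) := by
    rw [← Finset.sum_sub_distrib]
    rw [← Finset.sum_subset (Finset.subset_univ {x, y})]
    · rw [Finset.sum_pair hne, Equiv.swap_apply_left, Equiv.swap_apply_right]
    · intro z _ hz
      simp only [Finset.mem_insert, Finset.mem_singleton, not_or] at hz
      rw [Equiv.swap_apply_of_ne_of_ne hz.1 hz.2, sub_self]
  have h1 : ((u y : Fin m) : ℤ) < ((u x : Fin m) : ℤ) := by exact_mod_cast hyx
  have h2 : (x.1.1 : ℤ) < (y.1.1 : ℤ) := by exact_mod_cast hlt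
  nlinarith

/-- Without the restriction to ordered columns one gets the same space of relations. -/
theorem hMap_mem_relations (c : ℕ) (hc : c + 1 < lam.rowLen 0) (v : ColumnModule lam m) :
    hMap lam m c v ∈ relations lam m := by
  obtain ⟨f, rfl⟩ := (antisymmetry lam m).mkQ_surjective v
  induction f using Finsupp.induction_linear with
  | zero => simp
  | add f g hf hg =>
    rw [map_add, map_add]
    exact add_mem hf hg
  | single t a =>
    obtain ⟨b, hb, hord⟩ := exists_columnsOrdered t
    have h : (antisymmetry lam m).mkQ (Finsupp.single t a) = a • colTabloid t := by
      unfold colTabloid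
      rw [← map_smul, Finsupp.smul_single_one]
    rw [h, map_smul, colTabloid_smul t b hb, map_smul]
    exact Submodule.smul_mem _ _ (Submodule.smul_mem _ _
      (Submodule.subset_span ⟨_, hord, c, hc, rfl⟩))

theorem columnRep_etaTableau (s : Equiv.Perm (Fin m)) (c : ℕ) (t : Tableau lam m) :
    columnRep lam m s (etaTableau c t) = etaTableau c (s • t) := by
  simp only [etaTableau, exchangeSum, map_sum, map_sub, columnRep_colTabloid]
  rfl

theorem relations_le_comap (s : Equiv.Perm (Fin m)) :
    relations lam m ≤ (relations lam m).comap (columnRep lam m s) := by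
  refine Submodule.span_le.2 ?_
  rintro _ ⟨t, _, c, hc, rfl⟩
  show columnRep lam m s (hMap lam m c (colTabloid t)) ∈ relations lam m
  rw [hMap_colTabloid, columnRep_etaTableau, ← hMap_colTabloid]
  exact hMap_mem_relations c hc _

/-- The quotient `M̃^lam / H̃^lam` as a representation of the symmetric group. -/
noncomputable def quotientRep (lam : YoungDiagram) (m : ℕ) :
    Representation ℂ (Equiv.Perm (Fin m)) (ColumnModule lam m ⧸ relations lam m) :=
  (columnRep lam m).quotient (relations lam m) relations_le_comap

end SpechtPresentation

/-!
The map `[t] ↦ ε_t` is well defined on column tabloids, equivariant, and onto the Specht module, so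
everything rests on its kernel being the space of relations.

The relations lie in the kernel because each dual Garnir relation, one for every box `y` of column
`c + 1`, holds for polytabloids (`polytabloid_eq_sum_exchange`): in the row tabloids involved, some
two of the entries that are permuted share a row.

Conversely, consider a linear functional on column tabloids that vanishes on the relations, that is,
on the sum over `y` of the Garnir relations. A positivity argument splits this sum
(`IsAlternating.eq_sum_exchange`): for `d y t = f t - ∑ x, f (exchange t x y)`, antisymmetry gives
`∑ t, |d y t| ^ 2 = (a + 1) * ∑ t, conj (f t) * d y t`, where `a` is the length of column `c`, and
the right hand side vanishes after summation over `y`. So every single Garnir relation holds, and by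
induction so do those that exchange several boxes at once (`IsAlternating.sum_multiExchanges`); here
one divides by a factorial. These suffice for the classical straightening algorithm: with
`∑ k, 2 ^ k * (column of k)` as the quantity that increases, `eq_zero_of_standard` shows that the
functional is determined by its values at the standard tableaux. Hence the standard column tabloids
span modulo the relations (`span_colTabloid_sup_relations`). As the standard polytabloids are
linearly independent (`linearIndependent_polytabloid`), the kernel is no larger than the space of
relations (`ker_polytabloidMap`).
-/

open scoped ComplexConjugate Nat

namespace SpechtPresentation

variable {lam : YoungDiagram} {m : ℕ}

/-! ### Positivity: from the summed to the single Garnir relations -/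

theorem mem_colCells {c : ℕ} {x : Cell lam} : x ∈ colCells lam c ↔ x.1.2 = c := by
  simp [colCells]

theorem ne_of_mem_colCells {c d : ℕ} (h : c ≠ d) {x y : Cell lam} (hx : x ∈ colCells lam c)
    (hy : y ∈ colCells lam d) : x ≠ y := by
  rintro rfl
  exact h ((mem_colCells.1 hx).symm.trans (mem_colCells.1 hy))

theorem exchange_exchange (t : Tableau lam m) (x y : Cell lam) :
    exchange (exchange t x y) x y = t := by
  ext z
  simp [exchange]

theorem exchange_exchange_exchange (t : Tableau lam m) {x y z : Cell lam} (hxz : x ≠ z)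
    (hxy : x ≠ y) :
    exchange (exchange t x z) y z = exchange (exchange t y z) x y := by
  unfold exchange
  rw [← Equiv.trans_assoc, ← Equiv.trans_assoc]
  congr 1
  show Equiv.swap x z * Equiv.swap y z = Equiv.swap y z * Equiv.swap x y
  rw [Equiv.mul_swap_eq_swap_mul (Equiv.swap y z) x y, Equiv.swap_apply_of_ne_of_ne hxy hxz,
    Equiv.swap_apply_left]

/-- The permutations of the boxes that preserve every column. -/
def colPerms (lam : YoungDiagram) : Finset (Equiv.Perm (Cell lam)) :=
  Finset.univ.filter fun q => ∀ x, (q x).1.2 = x.1.2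

theorem mem_colPerms {q : Equiv.Perm (Cell lam)} :
    q ∈ colPerms lam ↔ ∀ x, (q x).1.2 = x.1.2 := by
  simp [colPerms]

theorem mul_mem_colPerms {p q : Equiv.Perm (Cell lam)} (hp : p ∈ colPerms lam)
    (hq : q ∈ colPerms lam) : p * q ∈ colPerms lam :=
  mem_colPerms.2 fun x => (mem_colPerms.1 hp (q x)).trans (mem_colPerms.1 hq x)

theorem inv_mem_colPerms {q : Equiv.Perm (Cell lam)} (hq : q ∈ colPerms lam) :
    q⁻¹ ∈ colPerms lam :=
  mem_colPerms.2 fun x => by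
    have h := mem_colPerms.1 hq (q⁻¹ x)
    rw [show q (q⁻¹ x) = x from q.apply_symm_apply x] at h
    exact h.symm

theorem swap_mem_colPerms {x y : Cell lam} (h : x.1.2 = y.1.2) :
    Equiv.swap x y ∈ colPerms lam :=
  mem_colPerms.2 fun z => by
    rw [Equiv.swap_apply_def]
    split_ifs with h1 h2
    · rw [h1, h]
    · rw [h2, h]
    · rfl

/-- A function of tableaux is alternating if it changes sign when two entries of the same column
are exchanged. -/
def IsAlternating {A : Type*} [Neg A] (f : Tableau lam m → A) : Prop :=
  ∀ (t : Tableau lam m) (x y : Cell lam), x ≠ y → x.1.2 = y.1.2 → f (exchange t x y) = -f t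

theorem isAlternating_colTabloid : IsAlternating (colTabloid (lam := lam) (m := m)) := by
  intro t x y hne hcol
  have h := colTabloid_rearrange (Equiv.swap x y) (mem_colPerms.1 (swap_mem_colPerms hcol)) t
  rw [h, Equiv.Perm.sign_swap hne]
  simp [exchange]

theorem IsAlternating.comp_linearMap {f : Tableau lam m → ColumnModule lam m}
    (hf : IsAlternating f) {A : Type*} [AddCommGroup A] [Module ℂ A]
    (g : ColumnModule lam m →ₗ[ℂ] A) : IsAlternating fun t => g (f t) := by
  intro t x y hne hcol
  simp only [hf t x y hne hcol, map_neg]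

/-- The dual Garnir relation of the box `y` is antisymmetric in all entries of column `c` and the
entry of `y` together: exchanging the entry of `y` with one of column `c` changes its sign. -/
theorem IsAlternating.garnir_exchange {A : Type*} [AddCommGroup A] {f : Tableau lam m → A}
    (hf : IsAlternating f) {c : ℕ} {x y : Cell lam} (hx : x ∈ colCells lam c)
    (hy : y ∈ colCells lam (c + 1)) (t : Tableau lam m) :
    f (exchange t x y) - ∑ z ∈ colCells lam c, f (exchange (exchange t x y) z y) =
      -(f t - ∑ z ∈ colCells lam c, f (exchange t z y)) := by
  rw [← Finset.add_sum_erase _ _ hx, ← Finset.add_sum_erase _ _ hx, exchange_exchange]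
  have h : ∑ z ∈ (colCells lam c).erase x, f (exchange (exchange t x y) z y) =
      -∑ z ∈ (colCells lam c).erase x, f (exchange t z y) := by
    rw [← Finset.sum_neg_distrib]
    refine Finset.sum_congr rfl fun z hz => ?_
    obtain ⟨hzx, hz⟩ := Finset.mem_erase.1 hz
    rw [exchange_exchange_exchange t (ne_of_mem_colCells c.lt_succ_self.ne hx hy) hzx.symm]
    exact hf _ _ _ hzx.symm ((mem_colCells.1 hx).trans (mem_colCells.1 hz).symm)
  rw [h]
  abel

/-- By antisymmetry, every term `f (exchange t x y)` of the Garnir expression contributes to its norm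
as much as the term `f t` does. -/
theorem IsAlternating.sum_conj_garnir_mul_garnir {f : Tableau lam m → ℂ}
    (hf : IsAlternating f) {c : ℕ} {y : Cell lam} (hy : y ∈ colCells lam (c + 1)) :
    ∑ t, conj (f t - ∑ x ∈ colCells lam c, f (exchange t x y)) *
        (f t - ∑ x ∈ colCells lam c, f (exchange t x y)) =
      ((colCells lam c).card + 1) *
        ∑ t, conj (f t) * (f t - ∑ x ∈ colCells lam c, f (exchange t x y)) := by
  set d : Tableau lam m → ℂ := fun t => f t - ∑ x ∈ colCells lam c, f (exchange t x y) with hd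
  -- Substituting `exchange t x y` for `t` changes the sign of the Garnir expression.
  have key : ∀ x ∈ colCells lam c,
      ∑ t, conj (f (exchange t x y)) * d t = -∑ t, conj (f t) * d t := by
    intro x hx
    rw [← Finset.sum_neg_distrib]
    refine Finset.sum_bij' (fun t _ => exchange t x y) (fun t _ => exchange t x y) ?_ ?_ ?_ ?_ ?_
    · simp
    · simp
    · intro t _
      exact exchange_exchange t x y
    · intro t _
      exact exchange_exchange t x y
    · intro t _
      rw [show d (exchange t x y) = -d t from hf.garnir_exchange hx hy t]
      ring
  calc ∑ t, conj (d t) * d t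
      = ∑ t, (conj (f t) * d t - ∑ x ∈ colCells lam c, conj (f (exchange t x y)) * d t) := by
        refine Finset.sum_congr rfl fun t _ => ?_
        rw [← Finset.sum_mul, ← sub_mul, ← map_sum, ← map_sub]
    _ = _ := by
        rw [Finset.sum_sub_distrib, Finset.sum_comm, Finset.sum_congr rfl key, Finset.sum_const,
          nsmul_eq_mul]
        ring

/-- If the sum of the Garnir relations over all boxes of column `c + 1` vanishes on `f`, then so does
each of them: pairing the sum with `f` gives, up to a positive factor, the sum of the squared norms
of the individual Garnir expressions. -/
theorem IsAlternating.eq_sum_exchange {f : Tableau lam m → ℂ} (hf : IsAlternating f) {c : ℕ}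
    (h : ∀ t, ∑ y ∈ colCells lam (c + 1), (f t - ∑ x ∈ colCells lam c, f (exchange t x y)) = 0)
    {y : Cell lam} (hy : y ∈ colCells lam (c + 1)) (t : Tableau lam m) :
    f t = ∑ x ∈ colCells lam c, f (exchange t x y) := by
  have h1 : ∑ y ∈ colCells lam (c + 1),
      ∑ t, conj (f t - ∑ x ∈ colCells lam c, f (exchange t x y)) *
        (f t - ∑ x ∈ colCells lam c, f (exchange t x y)) = 0 := by
    rw [Finset.sum_congr rfl fun y hy => hf.sum_conj_garnir_mul_garnir hy, ← Finset.mul_sum,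
      Finset.sum_comm]
    simp_rw [← Finset.mul_sum, h]
    simp
  simp_rw [← Complex.normSq_eq_conj_mul_self] at h1
  norm_cast at h1
  have h2 := (Finset.sum_eq_zero_iff_of_nonneg fun y _ =>
    Finset.sum_nonneg fun t _ => Complex.normSq_nonneg _).1 h1 y hy
  have h3 := (Finset.sum_eq_zero_iff_of_nonneg fun t _ => Complex.normSq_nonneg _).1 h2 t
    (Finset.mem_univ t)
  exact sub_eq_zero.1 (Complex.normSq_eq_zero.1 h3)

/-! ### Garnir relations exchanging several boxes -/

open Classical in
/-- The permutations of the boxes that exchange the boxes of `Y` with as many boxes of column `c`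
and fix all other boxes. -/
noncomputable def multiExchanges (c : ℕ) (Y : Finset (Cell lam)) :
    Finset (Equiv.Perm (Cell lam)) :=
  Finset.univ.filter fun p => (∀ z, p (p z) = z) ∧ (∀ y ∈ Y, p y ∈ colCells lam c) ∧
    ∀ z, z ∉ Y → p z ∉ Y → p z = z

theorem mem_multiExchanges {c : ℕ} {Y : Finset (Cell lam)} {p : Equiv.Perm (Cell lam)} :
    p ∈ multiExchanges c Y ↔ (∀ z, p (p z) = z) ∧ (∀ y ∈ Y, p y ∈ colCells lam c) ∧
      ∀ z, z ∉ Y → p z ∉ Y → p z = z := by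
  simp [multiExchanges]

theorem multiExchanges_empty (c : ℕ) : multiExchanges c (∅ : Finset (Cell lam)) = {1} := by
  ext p
  rw [mem_multiExchanges, Finset.mem_singleton]
  constructor
  · rintro ⟨-, -, h⟩
    ext1 z
    exact h z (Finset.notMem_empty _) (Finset.notMem_empty _)
  · rintro rfl
    simp

theorem apply_eq_self_of_mem_multiExchanges {c : ℕ} {Y : Finset (Cell lam)}
    {p : Equiv.Perm (Cell lam)} (hp : p ∈ multiExchanges c Y) {y : Cell lam}
    (hy : y ∈ colCells lam (c + 1)) (hyY : y ∉ Y) : p y = y := by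
  obtain ⟨h1, h2, h3⟩ := mem_multiExchanges.1 hp
  refine h3 y hyY fun h => ?_
  have := h2 _ h
  rw [h1] at this
  exact ne_of_mem_colCells c.lt_succ_self.ne this hy rfl

theorem mul_swap_mem_multiExchanges {c : ℕ} {Y : Finset (Cell lam)}
    (hY : Y ⊆ colCells lam (c + 1)) {p : Equiv.Perm (Cell lam)} (hp : p ∈ multiExchanges c Y)
    {x y : Cell lam} (hx : x ∈ colCells lam c) (hpx : p x = x) (hy : y ∈ colCells lam (c + 1))
    (hyY : y ∉ Y) : p * Equiv.swap x y ∈ multiExchanges c (insert y Y) := by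
  classical
  obtain ⟨h1, h2, h3⟩ := mem_multiExchanges.1 hp
  have hpy := apply_eq_self_of_mem_multiExchanges hp hy hyY
  have hcomm : p * Equiv.swap x y = Equiv.swap x y * p := by
    rw [Equiv.mul_swap_eq_swap_mul, hpx, hpy]
  refine mem_multiExchanges.2 ⟨fun z => ?_, fun z hz => ?_, fun z hz hz' => ?_⟩
  · nth_rw 2 [hcomm]
    simp [h1]
  · rcases Finset.mem_insert.1 hz with rfl | hz
    · simpa [hpx] using hx
    · rw [Equiv.Perm.mul_apply, Equiv.swap_apply_of_ne_of_ne]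
      · exact h2 z hz
      · exact (ne_of_mem_colCells c.lt_succ_self.ne hx (hY hz)).symm
      · exact fun h => hyY (h ▸ hz)
  · rw [Finset.mem_insert, not_or] at hz hz'
    rw [Equiv.Perm.mul_apply] at hz' ⊢
    by_cases hzx : z = x
    · subst hzx
      rw [Equiv.swap_apply_left, hpy] at hz'
      exact absurd rfl hz'.1
    · rw [Equiv.swap_apply_of_ne_of_ne hzx hz.1] at hz' ⊢
      exact h3 z hz.2 hz'.2

theorem mul_swap_mem_multiExchanges_of_insert {c : ℕ} {Y : Finset (Cell lam)}
    (hY : Y ⊆ colCells lam (c + 1)) {y : Cell lam} (hyY : y ∉ Y)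
    {p : Equiv.Perm (Cell lam)} (hp : p ∈ multiExchanges c (insert y Y)) :
    p * Equiv.swap (p y) y ∈ multiExchanges c Y := by
  classical
  obtain ⟨h1, h2, h3⟩ := mem_multiExchanges.1 hp
  have hx := h2 y (Finset.mem_insert_self _ _)
  have hcomm : p * Equiv.swap (p y) y = Equiv.swap (p y) y * p := by
    rw [Equiv.mul_swap_eq_swap_mul, h1, Equiv.swap_comm]
  refine mem_multiExchanges.2 ⟨fun z => ?_, fun z hz => ?_, fun z hz hz' => ?_⟩
  · nth_rw 2 [hcomm]
    simp [h1]
  · rw [Equiv.Perm.mul_apply, Equiv.swap_apply_of_ne_of_ne]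
    · exact h2 z (Finset.mem_insert_of_mem hz)
    · exact (ne_of_mem_colCells c.lt_succ_self.ne hx (hY hz)).symm
    · exact fun h => hyY (h ▸ hz)
  · rw [Equiv.Perm.mul_apply] at hz' ⊢
    by_cases hzx : z = p y
    · rw [hzx, Equiv.swap_apply_left]
    by_cases hzy : z = y
    · rw [hzy, Equiv.swap_apply_right, h1]
    rw [Equiv.swap_apply_of_ne_of_ne hzx hzy] at hz' ⊢
    refine h3 z (by simp [hzy, hz]) ?_
    rw [Finset.mem_insert, not_or]
    refine ⟨fun h => hzx ?_, hz'⟩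
    rw [← h, h1]

/-- An exchange of `insert y Y` is an exchange `p` of `Y`, together with a box of column `c` that `p`
does not move, to be exchanged with `y`. -/
theorem sum_multiExchanges_insert {A : Type*} [AddCommMonoid A]
    (F : Equiv.Perm (Cell lam) → A) {c : ℕ} {Y : Finset (Cell lam)}
    (hY : Y ⊆ colCells lam (c + 1)) {y : Cell lam} (hy : y ∈ colCells lam (c + 1)) (hyY : y ∉ Y) :
    ∑ p ∈ multiExchanges c (insert y Y), F p =
      ∑ p ∈ multiExchanges c Y, ∑ x ∈ colCells lam c with p x = x, F (p * Equiv.swap x y) := by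
  classical
  rw [Finset.sum_sigma']
  refine Finset.sum_bij' (fun p _ => ⟨p * Equiv.swap (p y) y, p y⟩)
    (fun q _ => q.1 * Equiv.swap q.2 y) ?_ ?_ ?_ ?_ ?_
  · intro p hp
    simp only [Finset.mem_sigma, Finset.mem_filter]
    refine ⟨mul_swap_mem_multiExchanges_of_insert hY hyY hp,
      (mem_multiExchanges.1 hp).2.1 y (Finset.mem_insert_self _ _), ?_⟩
    rw [Equiv.Perm.mul_apply, Equiv.swap_apply_left]
  · rintro ⟨p, x⟩ h
    simp only [Finset.mem_sigma, Finset.mem_filter] at h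
    exact mul_swap_mem_multiExchanges hY h.1 h.2.1 h.2.2 hy hyY
  · intro p _
    simp [mul_assoc]
  · rintro ⟨p, x⟩ h
    simp only [Finset.mem_sigma, Finset.mem_filter] at h
    simp [mul_assoc, h.2.2]
  · intro p _
    simp [mul_assoc]

theorem sum_moved_eq_sum {A : Type*} [AddCommMonoid A] (F : Cell lam → A) {c : ℕ}
    {Y : Finset (Cell lam)} (hY : Y ⊆ colCells lam (c + 1)) {p : Equiv.Perm (Cell lam)}
    (hp : p ∈ multiExchanges c Y) :
    ∑ x ∈ colCells lam c with ¬ p x = x, F x = ∑ y ∈ Y, F (p y) := by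
  obtain ⟨h1, h2, h3⟩ := mem_multiExchanges.1 hp
  refine Finset.sum_bij' (fun x _ => p x) (fun y _ => p y) ?_ ?_ ?_ ?_ ?_
  · intro x hx
    obtain ⟨hx, hpx⟩ := Finset.mem_filter.1 hx
    by_contra hcon
    exact hpx (h3 x (fun h => ne_of_mem_colCells c.lt_succ_self.ne hx (hY h) rfl) hcon)
  · intro y hy
    refine Finset.mem_filter.2 ⟨h2 y hy, fun h => ?_⟩
    rw [h1] at h
    exact ne_of_mem_colCells c.lt_succ_self.ne (h2 y hy) (hY hy) h.symm
  · intro x _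
    exact h1 x
  · intro y _
    exact h1 y
  · intro x _
    simp [h1]

/-- If the single box Garnir relations hold for `f`, then so do those that exchange a whole set `Y` of
boxes of column `c + 1`. The factor `Y.card !` counts the bijections from `Y` to its image. -/
theorem IsAlternating.sum_multiExchanges {A : Type*} [AddCommGroup A] {f : Tableau lam m → A}
    (hf : IsAlternating f) {c : ℕ}
    (h : ∀ t, ∀ y ∈ colCells lam (c + 1), f t = ∑ x ∈ colCells lam c, f (exchange t x y))
    {Y : Finset (Cell lam)} (hY : Y ⊆ colCells lam (c + 1)) (t : Tableau lam m) :
    ∑ p ∈ multiExchanges c Y, f (p.trans t) = Y.card ! • f t := by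
  classical
  induction Y using Finset.induction_on generalizing t with
  | empty => simp [multiExchanges_empty, Equiv.Perm.one_def]
  | insert y Y hyY ih =>
    have hy := hY (Finset.mem_insert_self y Y)
    have hY' : Y ⊆ colCells lam (c + 1) := (Finset.subset_insert y Y).trans hY
    -- Exchange `y` with all of column `c`; the boxes that `p` moves there contribute the terms in
    -- which `y` is exchanged with a box of `Y`, which are known since `f` is alternating.
    have key : ∀ p ∈ multiExchanges c Y,
        ∑ x ∈ colCells lam c with p x = x, f ((p * Equiv.swap x y).trans t) =
          f (p.trans t) - ∑ z ∈ Y, f (p.trans (exchange t z y)) := by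
      intro p hp
      have hpy := apply_eq_self_of_mem_multiExchanges hp hy hyY
      rw [eq_sub_iff_add_eq, h (p.trans t) y hy, ← Finset.sum_filter_add_sum_filter_not
        (colCells lam c) (fun x => p x = x) fun x => f (exchange (p.trans t) x y),
        sum_moved_eq_sum _ hY' hp]
      congr 1
      refine Finset.sum_congr rfl fun z _ => ?_
      have e : p * Equiv.swap (p z) y = Equiv.swap z y * p := by
        rw [Equiv.mul_swap_eq_swap_mul, (mem_multiExchanges.1 hp).1, hpy]
      show f ((Equiv.swap z y * p).trans t) = f ((p * Equiv.swap (p z) y).trans t)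
      rw [e]
    rw [sum_multiExchanges_insert (fun p => f (p.trans t)) hY' hy hyY, Finset.sum_congr rfl key,
      Finset.sum_sub_distrib, ih hY', Finset.sum_comm]
    have h2 : ∀ z ∈ Y, ∑ p ∈ multiExchanges c Y, f (p.trans (exchange t z y)) =
        -(Y.card ! • f t) := by
      intro z hz
      rw [ih hY', hf t z y (by rintro rfl; exact hyY hz)
        ((mem_colCells.1 (hY' hz)).trans (mem_colCells.1 hy).symm), smul_neg]
    rw [Finset.sum_congr rfl h2, Finset.sum_const, Finset.card_insert_of_notMem hyY,
      Nat.factorial_succ, smul_neg, sub_neg_eq_add, ← mul_smul, ← add_smul]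
    congr 1
    ring

/-! ### Garnir relations for polytabloids -/

theorem permCongr_trans (t : Tableau lam m) (b : Equiv.Perm (Fin m)) :
    (t.symm.permCongr b).trans t = b • t := by
  ext x
  rw [smul_tableau_apply]
  simp [Equiv.permCongr_apply]

theorem permCongr_mem_colPerms (t : Tableau lam m) (b : Equiv.Perm (Fin m)) :
    t.symm.permCongr b ∈ colPerms lam ↔ b ∈ colStabilizer t := by
  rw [mem_colPerms, mem_colStabilizer]
  constructor
  · intro h k
    simpa [Equiv.permCongr_apply] using h (t.symm k)
  · intro h x
    simpa [Equiv.permCongr_apply] using h (t x)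

theorem polytabloid_eq_sum_colPerms (t : Tableau lam m) :
    polytabloid t = ∑ q ∈ colPerms lam,
      ((Equiv.Perm.sign q : ℤ) : ℂ) • Finsupp.single (rowTabloid (q.trans t)) 1 := by
  classical
  unfold polytabloid
  refine Finset.sum_equiv t.symm.permCongr ?_ ?_
  · intro b
    simp [permCongr_mem_colPerms]
  · intro b _
    rw [permCongr_trans, Equiv.Perm.sign_permCongr]

theorem polytabloid_smul (t : Tableau lam m) (b : Equiv.Perm (Fin m))
    (hb : b ∈ colStabilizer t) :
    polytabloid t = ((Equiv.Perm.sign b : ℤ) : ℂ) • polytabloid (b • t) := by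
  rw [polytabloid_eq_sum_colPerms, polytabloid_eq_sum_colPerms, Finset.smul_sum,
    ← permCongr_trans]
  have hg := (permCongr_mem_colPerms t b).2 hb
  rw [← Equiv.Perm.sign_permCongr t.symm b]
  set g := t.symm.permCongr b
  symm
  refine Finset.sum_bij' (fun q _ => g * q) (fun q _ => g⁻¹ * q) ?_ ?_ ?_ ?_ ?_
  · exact fun q hq => mul_mem_colPerms hg hq
  · exact fun q hq => mul_mem_colPerms (inv_mem_colPerms hg) hq
  · intro q _
    simp
  · intro q _
    simp
  · intro q _
    rw [smul_smul, Equiv.Perm.sign_mul]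
    push_cast
    rfl

theorem rowTabloid_swap {x y : Cell lam} (h : x.1.1 = y.1.1) (t : Tableau lam m) :
    rowTabloid ((Equiv.swap x y).trans t) = rowTabloid t := by
  refine Quotient.sound fun k => ?_
  show ((Equiv.swap x y).symm (t.symm k)).1.1 = _
  rw [Equiv.symm_swap, Equiv.swap_apply_def]
  split_ifs with h1 h2
  · rw [h1, h]
  · rw [h2, h]
  · rfl

/-- The box to the left of a box `y`; boxes of column `0` are sent to themselves. -/
def leftCell (y : Cell lam) : Cell lam :=
  ⟨(y.1.1, y.1.2 - 1), lam.up_left_mem le_rfl (Nat.sub_le _ _) y.2⟩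

/-- Polytabloids satisfy the dual Garnir relations. In the double sum over column preserving `q` and
boxes `x` of column `c`, let `u q` be the box where `q` puts the left neighbour of the box that it
puts at `y`. The terms with `x = u q` add up to the left hand side, and the other ones cancel in
pairs under `(q, x) ↦ (swap (u q) x * q, u q)`. -/
theorem polytabloid_eq_sum_exchange {c : ℕ} {y : Cell lam} (hy : y ∈ colCells lam (c + 1))
    (t : Tableau lam m) :
    polytabloid t = ∑ x ∈ colCells lam c, polytabloid (exchange t x y) := by
  classical
  let u : Equiv.Perm (Cell lam) → Cell lam := fun q => q (leftCell (q⁻¹ y))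
  have hu : ∀ q ∈ colPerms lam, u q ∈ colCells lam c := by
    intro q hq
    refine mem_colCells.2 ?_
    rw [mem_colPerms.1 hq]
    show (q⁻¹ y).1.2 - 1 = c
    rw [mem_colPerms.1 (inv_mem_colPerms hq), mem_colCells.1 hy]
    rfl
  -- Exchanging `u q` and `y` after `q` amounts to exchanging two boxes of a row before `q`.
  have hswap : ∀ q (s : Tableau lam m),
      rowTabloid ((Equiv.swap (u q) y * q).trans s) = rowTabloid (q.trans s) := by
    intro q s
    have e : Equiv.swap (u q) y * q = q * Equiv.swap (leftCell (q⁻¹ y)) (q⁻¹ y) := by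
      rw [Equiv.mul_swap_eq_swap_mul, show q (q⁻¹ y) = y from q.apply_symm_apply y]
    rw [e]
    exact rowTabloid_swap (x := leftCell (q⁻¹ y)) (y := q⁻¹ y) rfl (q.trans s)
  let F : Equiv.Perm (Cell lam) × Cell lam → (RowTabloid lam m →₀ ℂ) := fun a =>
    ((Equiv.Perm.sign a.1 : ℤ) : ℂ) •
      Finsupp.single (rowTabloid ((Equiv.swap a.2 y * a.1).trans t)) 1
  have hsum : ∑ x ∈ colCells lam c, polytabloid (exchange t x y) =
      ∑ q ∈ colPerms lam, ∑ x ∈ colCells lam c, F (q, x) := by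
    rw [Finset.sum_comm]
    refine Finset.sum_congr rfl fun x _ => ?_
    rw [polytabloid_eq_sum_colPerms]
    rfl
  have hzero : ∑ a ∈ (colPerms lam ×ˢ colCells lam c) with a.2 ≠ u a.1, F a = 0 := by
    refine Finset.sum_involution (fun a _ => (Equiv.swap (u a.1) a.2 * a.1, u a.1)) ?_ ?_ ?_ ?_
    all_goals
      rintro ⟨q, x⟩ ha
      rw [Finset.mem_filter, Finset.mem_product] at ha
      obtain ⟨⟨hq, hx⟩, hne⟩ := ha
      dsimp only at hq hx hne ⊢
      have hyu : y ≠ u q := (ne_of_mem_colCells c.lt_succ_self.ne (hu q hq) hy).symm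
      have hyx : y ≠ x := (ne_of_mem_colCells c.lt_succ_self.ne hx hy).symm
      have hcol : (u q).1.2 = x.1.2 := (mem_colCells.1 (hu q hq)).trans (mem_colCells.1 hx).symm
      have hu2 : u (Equiv.swap (u q) x * q) = x := by
        show Equiv.swap (u q) x (q (leftCell ((Equiv.swap (u q) x * q)⁻¹ y))) = x
        rw [mul_inv_rev, Equiv.swap_inv, Equiv.Perm.mul_apply,
          Equiv.swap_apply_of_ne_of_ne hyu hyx]
        exact Equiv.swap_apply_left _ _
    · have e : Equiv.swap (u q) y * (Equiv.swap (u q) x * q) =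
          Equiv.swap x y * (Equiv.swap (u q) y * q) := by
        rw [← mul_assoc, Equiv.mul_swap_eq_swap_mul, Equiv.swap_apply_left,
          Equiv.swap_apply_of_ne_of_ne hne hyx.symm, Equiv.swap_comm y x, mul_assoc]
      simp only [F]
      rw [e, Equiv.Perm.sign_mul, Equiv.Perm.sign_swap hne.symm]
      have h := hswap q ((Equiv.swap x y).trans t)
      rw [show rowTabloid ((Equiv.swap x y * (Equiv.swap (u q) y * q)).trans t) =
        rowTabloid ((Equiv.swap x y * q).trans t) from h]
      simp
    · intro _ h
      exact hne (Prod.ext_iff.1 h).2.symm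
    · rw [Finset.mem_filter, Finset.mem_product]
      refine ⟨⟨mul_mem_colPerms (swap_mem_colPerms hcol) hq, hu q hq⟩, ?_⟩
      rw [hu2]
      exact hne.symm
    · rw [hu2, Equiv.swap_comm x, Equiv.swap_mul_self_mul]
  rw [hsum, ← Finset.sum_product', ← Finset.sum_filter_add_sum_filter_not _
    (fun a => a.2 ≠ u a.1), hzero, zero_add, polytabloid_eq_sum_colPerms]
  refine Finset.sum_bij' (fun q _ => (q, u q)) (fun a _ => a.1) ?_ ?_ ?_ ?_ ?_
  · intro q hq
    simp [hq, hu q hq]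
  · intro a ha
    exact (Finset.mem_product.1 (Finset.mem_filter.1 ha).1).1
  · intro q _
    rfl
  · rintro ⟨q, x⟩ ha
    have := (Finset.mem_filter.1 ha).2
    simp only [not_not] at this
    rw [← this]
  · intro q _
    simp only [F]
    rw [hswap]

/-! ### Linear independence of the standard polytabloids -/

/-- A tableau is standard if its entries increase down the columns and along the rows. -/
def IsStandard (t : Tableau lam m) : Prop :=
  ColumnsOrdered t ∧ ∀ x y : Cell lam, x.1.1 = y.1.1 → x.1.2 < y.1.2 → t x < t y

/-- A permutation that preserves the fibers of `a` and is strictly increasing on each of them,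
when the fibers are ordered by `b`, is the identity. -/
theorem perm_eq_one_of_strictMono_on_fibers {α : Type*} (q : Equiv.Perm α) (a b : α → ℕ)
    (hab : ∀ x y, a x = a y → b x = b y → x = y) (ha : ∀ x, a (q x) = a x)
    (hb : ∀ x y, a x = a y → b x < b y → b (q x) < b (q y)) : q = 1 := by
  suffices h : ∀ n x, b x = n → q x = x by
    ext1 x
    exact h _ x rfl
  intro n
  induction n using Nat.strong_induction_on with
  | _ n ih =>
    intro x hx
    by_contra hne
    have hlt : b x < b (q x) := by
      rcases lt_trichotomy (b (q x)) (b x) with h | h | h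
      · exact absurd (q.injective (ih _ (hx ▸ h) _ rfl)) hne
      · exact absurd (hab _ _ (ha x) h) hne
      · exact h
    obtain ⟨z, rfl⟩ := q.surjective x
    have haz := ha z
    rcases lt_trichotomy (b z) (b (q z)) with h | h | h
    · exact hne (congrArg q (ih _ (hx ▸ h) _ rfl))
    · exact hne (congrArg q (hab _ _ haz h.symm))
    · exact absurd (hb _ _ haz h) (not_lt.2 hlt.le)

theorem cell_ext {x y : Cell lam} (h1 : x.1.1 = y.1.1) (h2 : x.1.2 = y.1.2) : x = y :=
  Subtype.ext (Prod.ext h1 h2)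

theorem eq_one_of_columnsOrdered {t : Tableau lam m} (ht : ColumnsOrdered t)
    {q : Equiv.Perm (Cell lam)} (hq : q ∈ colPerms lam) (hqt : ColumnsOrdered (q.trans t)) :
    q = 1 := by
  have hcol := mem_colPerms.1 hq
  refine perm_eq_one_of_strictMono_on_fibers q (fun x => x.1.2) (fun x => x.1.1)
    (fun x y h1 h2 => cell_ext h2 h1) hcol fun x y hxy hlt => ?_
  have h : t (q x) < t (q y) := hqt x y hxy hlt
  have hxy' : (q x).1.2 = (q y).1.2 := (hcol x).trans (hxy.trans (hcol y).symm)
  rcases lt_trichotomy (q x).1.1 (q y).1.1 with h1 | h1 | h1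
  · exact h1
  · rw [cell_ext h1 hxy'] at h
    exact absurd h (lt_irrefl _)
  · exact absurd (ht _ _ hxy'.symm h1) h.asymm

theorem IsStandard.eq_of_rowTabloid_eq {s t : Tableau lam m} (hs : IsStandard s)
    (ht : IsStandard t) (h : rowTabloid s = rowTabloid t) : s = t := by
  have hrow : ∀ k, (s.symm k).1.1 = (t.symm k).1.1 := Quotient.exact h
  have hq : ∀ x, (t.symm (s x)).1.1 = x.1.1 := fun x => by
    rw [← hrow, Equiv.symm_apply_apply]
  have h1 : s.trans t.symm = 1 := by
    refine perm_eq_one_of_strictMono_on_fibers _ (fun x => x.1.1) (fun x => x.1.2)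
      (fun x y h1 h2 => cell_ext h1 h2) hq fun x y hxy hlt => ?_
    have h2 := hs.2 x y hxy hlt
    show (t.symm (s x)).1.2 < (t.symm (s y)).1.2
    have hxy' : (t.symm (s x)).1.1 = (t.symm (s y)).1.1 := (hq x).trans (hxy.trans (hq y).symm)
    rcases lt_trichotomy (t.symm (s x)).1.2 (t.symm (s y)).1.2 with h3 | h3 | h3
    · exact h3
    · have := t.symm.injective (cell_ext hxy' h3)
      rw [this] at h2
      exact absurd h2 (lt_irrefl _)
    · have := ht.2 _ _ hxy'.symm h3
      rw [Equiv.apply_symm_apply, Equiv.apply_symm_apply] at this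
      exact absurd this h2.asymm
  ext1 x
  have := congrArg t (Equiv.congr_fun h1 x)
  simpa using this

/-- The sum of all entries of `t`, each multiplied by the index of its row. -/
def rowWeight (t : Tableau lam m) : ℕ := ∑ x : Cell lam, x.1.1 * (t x : ℕ)

theorem rowWeight_eq_of_rowTabloid_eq {s t : Tableau lam m} (h : rowTabloid s = rowTabloid t) :
    rowWeight s = rowWeight t := by
  have hrow : ∀ k, (s.symm k).1.1 = (t.symm k).1.1 := Quotient.exact h
  have e : ∀ u : Tableau lam m, rowWeight u = ∑ k : Fin m, (u.symm k).1.1 * (k : ℕ) := by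
    intro u
    rw [← Equiv.sum_comp u]
    simp [rowWeight]
  rw [e, e]
  simp_rw [hrow]

/-- By the rearrangement inequality, a tableau with ordered columns has the largest row weight among
its column rearrangements. -/
theorem ColumnsOrdered.rowWeight_lt {t : Tableau lam m} (ht : ColumnsOrdered t)
    {q : Equiv.Perm (Cell lam)} (hq : q ∈ colPerms lam) (hne : q ≠ 1) :
    rowWeight (q.trans t) < rowWeight t := by
  have hcol := mem_colPerms.1 hq
  -- Adding large multiples of the column index to both factors makes them vary together on the
  -- whole diagram, not only on each column.
  obtain ⟨B, hB⟩ : ∃ B : ℕ, ∀ x : Cell lam, x.1.1 < B :=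
    ⟨∑ x : Cell lam, x.1.1 + 1, fun x => Nat.lt_succ_of_le
      (Finset.single_le_sum (f := fun x : Cell lam => x.1.1) (fun _ _ => Nat.zero_le _)
        (Finset.mem_univ x))⟩
  let f : Cell lam → ℕ := fun x => x.1.1 + B * x.1.2
  let g : Cell lam → ℕ := fun x => t x + m * x.1.2
  have hfg : Monovary f g := by
    intro x y hxy
    have h1 := hB x
    have h2 := (t x).2
    have h3 := (t y).2
    simp only [f, g] at hxy ⊢
    rcases lt_trichotomy x.1.2 y.1.2 with h | h | h
    · nlinarith
    · rw [h] at hxy ⊢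
      by_contra hcon
      have := ht y x h.symm (by omega)
      have : (t y : ℕ) < t x := this
      omega
    · nlinarith
  have hsum : ∀ p ∈ colPerms lam, ∑ x, f x * g (p x) = rowWeight (p.trans t) +
      (∑ x : Cell lam, (B * x.1.2) * (t x : ℕ) + ∑ x, f x * (m * x.1.2)) := by
    intro p hp
    have hp := mem_colPerms.1 hp
    have e : ∑ x : Cell lam, (B * x.1.2) * (t x : ℕ) =
        ∑ x : Cell lam, (B * x.1.2) * (t (p x) : ℕ) := by
      rw [← Equiv.sum_comp p]
      simp_rw [hp]
    rw [e, rowWeight, ← Finset.sum_add_distrib, ← Finset.sum_add_distrib]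
    refine Finset.sum_congr rfl fun x _ => ?_
    simp only [f, g, hp, Equiv.trans_apply]
    ring
  have h1 : ∑ x, f x * g (q x) < ∑ x, f x * g x := by
    refine hfg.sum_mul_comp_perm_lt_sum_mul_iff.2 fun hcon => hne ?_
    refine eq_one_of_columnsOrdered ht hq fun x y hxy hlt => ?_
    have hf : f x < f y := by
      simp only [f, hxy]
      omega
    have h2 := hcon.symm hf
    simp only [Function.comp, g, hcol, hxy] at h2
    show t (q x) < t (q y)
    refine lt_of_le_of_ne (Fin.le_def.2 (by omega)) fun h => ?_
    have := q.injective (t.injective h)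
    rw [this] at hlt
    exact lt_irrefl _ hlt
  have h2 := hsum 1 (mem_colPerms.2 fun _ => rfl)
  have h3 := hsum q hq
  have h4 : (1 : Equiv.Perm (Cell lam)).trans t = t := rfl
  rw [h4] at h2
  simp only [Equiv.Perm.coe_one, id] at h2
  omega

theorem ColumnsOrdered.polytabloid_apply_self {t : Tableau lam m} (ht : ColumnsOrdered t) :
    polytabloid t (rowTabloid t) = 1 := by
  classical
  rw [polytabloid_eq_sum_colPerms, Finsupp.finsetSum_apply, Finset.sum_eq_single 1]
  · have h4 : (1 : Equiv.Perm (Cell lam)).trans t = t := rfl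
    rw [h4]
    simp
  · intro q hq hne
    rw [Finsupp.smul_apply, Finsupp.single_eq_of_ne, smul_zero]
    intro h
    exact (ht.rowWeight_lt hq hne).ne (rowWeight_eq_of_rowTabloid_eq h.symm)
  · intro h
    exact absurd (mem_colPerms.2 fun _ => rfl) h

theorem ColumnsOrdered.rowWeight_lt_of_polytabloid_apply_ne_zero {s t : Tableau lam m}
    (ht : ColumnsOrdered t) (h : polytabloid t (rowTabloid s) ≠ 0) :
    rowWeight s < rowWeight t ∨ rowTabloid s = rowTabloid t := by
  classical
  rw [polytabloid_eq_sum_colPerms, Finsupp.finsetSum_apply] at h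
  obtain ⟨q, hq, hne⟩ := Finset.exists_ne_zero_of_sum_ne_zero h
  have hqs : rowTabloid s = rowTabloid (q.trans t) := by
    by_contra hcon
    rw [Finsupp.smul_apply, Finsupp.single_eq_of_ne hcon, smul_zero] at hne
    exact hne rfl
  by_cases hq1 : q = 1
  · right
    rw [hqs, hq1]
    rfl
  · left
    rw [rowWeight_eq_of_rowTabloid_eq hqs]
    exact ht.rowWeight_lt hq hq1

/-- The polytabloid of a standard tableau `t` is `{t}` plus a combination of tabloids of smaller row
weight, and distinct standard tableaux have distinct tabloids. -/
theorem linearIndependent_polytabloid :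
    LinearIndependent ℂ fun t : {t : Tableau lam m // IsStandard t} => polytabloid t.1 := by
  classical
  have : Fintype {t : Tableau lam m // IsStandard t} := Fintype.ofFinite _
  rw [Fintype.linearIndependent_iff]
  intro g hg
  by_contra! hcon
  obtain ⟨i₀, hi₀⟩ := hcon
  obtain ⟨i, hi, hmax⟩ := Finset.exists_max_image
    (Finset.univ.filter fun i : {t : Tableau lam m // IsStandard t} => g i ≠ 0)
    (fun i => rowWeight i.1) ⟨i₀, by simp [hi₀]⟩
  simp only [Finset.mem_filter, Finset.mem_univ, true_and] at hi hmax
  have h := DFunLike.congr_fun hg (rowTabloid i.1)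
  rw [Finsupp.finsetSum_apply, Finset.sum_eq_single i] at h
  · rw [Finsupp.smul_apply, i.2.1.polytabloid_apply_self] at h
    simp [hi] at h
  · intro j _ hji
    by_contra hne
    rw [Finsupp.smul_apply, smul_eq_mul] at hne
    obtain ⟨h1, h2⟩ := mul_ne_zero_iff.1 hne
    rcases j.2.1.rowWeight_lt_of_polytabloid_apply_ne_zero h2 with h3 | h3
    · exact absurd (hmax j h1) (not_le.2 h3)
    · exact hji (Subtype.ext (i.2.eq_of_rowTabloid_eq j.2 h3).symm)
  · simp

/-! ### Straightening -/

/-- The sum of the numbers `2 ^ k`, each multiplied by the index of the column of `t` that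
contains the entry `k`. -/
def colWeight (t : Tableau lam m) : ℕ := ∑ k : Fin m, 2 ^ (k : ℕ) * (t.symm k).1.2

theorem colWeight_smul (t : Tableau lam m) {b : Equiv.Perm (Fin m)} (hb : b ∈ colStabilizer t) :
    colWeight (b • t) = colWeight t := by
  have h := (colStabilizer t).inv_mem hb
  refine Finset.sum_congr rfl fun k _ => ?_
  rw [smul_tableau_symm, h k]

theorem exists_descent {t : Tableau lam m} (ht : ColumnsOrdered t) (hns : ¬ IsStandard t) :
    ∃ x y : Cell lam, x.1.1 = y.1.1 ∧ y.1.2 = x.1.2 + 1 ∧ t y < t x := by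
  by_contra! hcon
  refine hns ⟨ht, ?_⟩
  suffices h : ∀ n (x y : Cell lam), x.1.1 = y.1.1 → y.1.2 = x.1.2 + 1 + n → t x < t y by
    intro x y hxy hlt
    exact h (y.1.2 - (x.1.2 + 1)) x y hxy (by omega)
  have adj : ∀ x y : Cell lam, x.1.1 = y.1.1 → y.1.2 = x.1.2 + 1 → t x < t y := by
    intro x y hxy h
    refine lt_of_le_of_ne (hcon x y hxy h) fun he => ?_
    have := t.injective he
    subst this
    omega
  intro n
  induction n with
  | zero => exact adj
  | succ n ih =>
    intro x y hxy h
    have h1 : (leftCell y).1.2 = y.1.2 - 1 := rfl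
    have h2 : (leftCell y).1.1 = y.1.1 := rfl
    exact (ih x (leftCell y) (by omega) (by omega)).trans (adj _ y h2 (by omega))

/-- At a descent `t y < t x` in adjacent boxes of a row, exchanging the boxes of column `c + 1` from
the top to `y` with boxes of column `c` moves to the right an entry `≥ t x`, and to the left only
entries `≤ t y`; as `2 ^ (t x)` exceeds the sum of the powers of `2` below it, the column weight
increases. -/
theorem ColumnsOrdered.colWeight_lt {t : Tableau lam m} (ht : ColumnsOrdered t) {c : ℕ}
    {x y : Cell lam} (hx : x ∈ colCells lam c) (hy : y ∈ colCells lam (c + 1))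
    (hxy : x.1.1 = y.1.1) (hlt : t y < t x) {p : Equiv.Perm (Cell lam)}
    (hp : p ∈ multiExchanges c {z ∈ colCells lam (c + 1) | z.1.1 ≤ y.1.1}) :
    colWeight t < colWeight (p.trans t) := by
  classical
  set Y := {z ∈ colCells lam (c + 1) | z.1.1 ≤ y.1.1} with hY
  obtain ⟨h1, h2, h3⟩ := mem_multiExchanges.1 hp
  have hYc : ∀ z ∈ Y, z ∈ colCells lam (c + 1) := fun z hz => (Finset.mem_filter.1 hz).1
  have e1 : colWeight t = ∑ z : Cell lam, 2 ^ (t z : ℕ) * z.1.2 := by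
    rw [colWeight, ← Equiv.sum_comp t]
    simp
  have e2 : colWeight (p.trans t) = ∑ z : Cell lam, 2 ^ (t z : ℕ) * (p z).1.2 := by
    rw [colWeight, ← Equiv.sum_comp t]
    refine Finset.sum_congr rfl fun z _ => ?_
    have : p.symm z = p z := by rw [Equiv.symm_apply_eq, h1]
    simp [this]
  -- The boxes of `Y` lose one column and their images gain one.
  have e3 : colWeight (p.trans t) + ∑ z ∈ Y, 2 ^ (t z : ℕ) =
      colWeight t + ∑ z ∈ Y, 2 ^ (t (p z) : ℕ) := by
    have e4 : ∑ z ∈ Y, 2 ^ (t (p z) : ℕ) = ∑ z : Cell lam with p z ∈ Y, 2 ^ (t z : ℕ) := by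
      refine Finset.sum_bij' (fun z _ => p z) (fun z _ => p z) ?_ ?_ ?_ ?_ ?_ <;> simp [h1]
    have e5 : ∑ z ∈ Y, 2 ^ (t z : ℕ) = ∑ z : Cell lam with z ∈ Y, 2 ^ (t z : ℕ) := by
      rw [Finset.filter_univ_mem]
    rw [e1, e2, e4, e5, Finset.sum_filter, Finset.sum_filter, ← Finset.sum_add_distrib,
      ← Finset.sum_add_distrib]
    refine Finset.sum_congr rfl fun z _ => ?_
    by_cases hz : z ∈ Y
    · have hpz := mem_colCells.1 (h2 z hz)
      have hzc := mem_colCells.1 (hYc z hz)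
      have hpz' : p z ∉ Y := fun h => by
        have := mem_colCells.1 (hYc _ h)
        omega
      rw [if_pos hz, if_neg hpz', hpz, hzc]
      ring
    · by_cases hpz : p z ∈ Y
      · have hzc := mem_colCells.1 (h2 _ hpz)
        rw [h1] at hzc
        have hpzc := mem_colCells.1 (hYc _ hpz)
        rw [if_neg hz, if_pos hpz, hpzc, hzc]
        ring
      · rw [if_neg hz, if_neg hpz, h3 z hz hpz]
  -- Not all boxes of `Y` can be sent to the rows above the row of `y`.
  obtain ⟨z, hz, hrow⟩ : ∃ z ∈ Y, y.1.1 ≤ (p z).1.1 := by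
    by_contra! hcon
    have hle : Y.card ≤ (Finset.range y.1.1).card := by
      refine Finset.card_le_card_of_injOn (fun z => (p z).1.1)
        (fun z hz => Finset.mem_coe.2 (Finset.mem_range.2 (hcon z hz))) ?_
      intro z hz z' hz' h
      exact p.injective (cell_ext h ((mem_colCells.1 (h2 z hz)).trans
        (mem_colCells.1 (h2 z' hz')).symm))
    have hyc := mem_colCells.1 hy
    have hge : (Finset.range (y.1.1 + 1)).card ≤ Y.card := by
      refine (Finset.card_le_card ?_).trans (Finset.card_image_le (f := fun z => z.1.1))
      intro i hi
      have hi : i ≤ y.1.1 := Nat.lt_succ_iff.1 (Finset.mem_range.1 hi)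
      refine Finset.mem_image.2 ⟨⟨(i, y.1.2), lam.up_left_mem hi le_rfl y.2⟩, ?_, rfl⟩
      exact Finset.mem_filter.2 ⟨mem_colCells.2 hyc, hi⟩
    rw [Finset.card_range] at hle hge
    omega
  have hxz : t x ≤ t (p z) := by
    rcases hrow.eq_or_lt with h | h
    · rw [cell_ext (hxy.trans h) ((mem_colCells.1 hx).trans (mem_colCells.1 (h2 z hz)).symm)]
    · exact (ht x (p z) ((mem_colCells.1 hx).trans (mem_colCells.1 (h2 z hz)).symm)
        (hxy ▸ h)).le
  have hsmall : ∑ z ∈ Y, 2 ^ (t z : ℕ) < 2 ^ (t x : ℕ) := by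
    have hinj : Set.InjOn (fun z => (t z : ℕ)) Y := fun z _ z' _ h =>
      t.injective (Fin.ext h)
    rw [← Finset.sum_image (f := fun k => 2 ^ k) hinj]
    refine Nat.geomSum_lt le_rfl fun k hk => ?_
    obtain ⟨z, hz, rfl⟩ := Finset.mem_image.1 hk
    obtain ⟨hzc, hzr⟩ := Finset.mem_filter.1 hz
    have hzy : t z ≤ t y := by
      rcases hzr.eq_or_lt with h | h
      · rw [cell_ext h ((mem_colCells.1 hzc).trans (mem_colCells.1 hy).symm)]
      · exact (ht z y ((mem_colCells.1 hzc).trans (mem_colCells.1 hy).symm) h).le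
    exact hzy.trans_lt hlt
  have hbig : 2 ^ (t (p z) : ℕ) ≤ ∑ z ∈ Y, 2 ^ (t (p z) : ℕ) :=
    Finset.single_le_sum (f := fun z => 2 ^ (t (p z) : ℕ)) (fun _ _ => Nat.zero_le _) hz
  have hpow : 2 ^ (t x : ℕ) ≤ 2 ^ (t (p z) : ℕ) := Nat.pow_le_pow_right two_pos hxz
  omega

theorem lt_rowLen_zero {c : ℕ} {y : Cell lam} (hy : y ∈ colCells lam c) : c < lam.rowLen 0 := by
  rw [← YoungDiagram.mem_iff_lt_rowLen]
  exact lam.up_left_mem (Nat.zero_le _) (mem_colCells.1 hy).ge y.2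

theorem eq_sum_exchange_of_relations_le_ker {g : ColumnModule lam m →ₗ[ℂ] ℂ}
    (hg : relations lam m ≤ LinearMap.ker g) {c : ℕ} {y : Cell lam}
    (hy : y ∈ colCells lam (c + 1)) (t : Tableau lam m) :
    g (colTabloid t) = ∑ x ∈ colCells lam c, g (colTabloid (exchange t x y)) := by
  refine (isAlternating_colTabloid.comp_linearMap g).eq_sum_exchange (fun s => ?_) hy t
  have h := hg (hMap_mem_relations c (lt_rowLen_zero hy) (colTabloid s))
  rw [LinearMap.mem_ker, hMap_colTabloid] at h
  simpa [etaTableau, exchangeSum] using h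

/-- Straightening, in dual form: a functional that kills the relations and the standard column
tabloids is zero. Otherwise take a tableau of largest column weight where it does not vanish; the
Garnir relation at a descent expresses its value by values at tableaux of larger column weight. -/
theorem eq_zero_of_standard {g : ColumnModule lam m →ₗ[ℂ] ℂ}
    (hg : relations lam m ≤ LinearMap.ker g)
    (hstd : ∀ t : Tableau lam m, IsStandard t → g (colTabloid t) = 0) (t : Tableau lam m) :
    g (colTabloid t) = 0 := by
  classical
  by_contra hne
  obtain ⟨t, ht, hmax⟩ := Finset.exists_max_image
    (Finset.univ.filter fun t : Tableau lam m => g (colTabloid t) ≠ 0) colWeight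
    ⟨t, by simp [hne]⟩
  simp only [Finset.mem_filter, Finset.mem_univ, true_and] at ht hmax
  obtain ⟨b, hb, hord⟩ := exists_columnsOrdered t
  have hbt : g (colTabloid (b • t)) ≠ 0 := fun h => ht (by
    rw [colTabloid_smul t b hb, map_smul, h, smul_zero])
  obtain ⟨x, y, hrow, hcol, hlt⟩ := exists_descent hord fun h => hbt (hstd _ h)
  have hy : y ∈ colCells lam (x.1.2 + 1) := mem_colCells.2 hcol
  have hsum := (isAlternating_colTabloid.comp_linearMap g).sum_multiExchanges
    (fun s z hz => eq_sum_exchange_of_relations_le_ker hg hz s)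
    (Finset.filter_subset (fun z : Cell lam => z.1.1 ≤ y.1.1) (colCells lam (x.1.2 + 1)))
    (b • t)
  rw [Finset.sum_eq_zero] at hsum
  · rcases smul_eq_zero.1 hsum.symm with h | h
    · exact Nat.factorial_ne_zero _ h
    · exact hbt h
  · intro p hp
    by_contra hcon
    -- A nonzero term would contradict the choice of `t`.
    have h1 := hmax _ hcon
    have h2 := hord.colWeight_lt (mem_colCells.2 rfl) hy hrow hlt hp
    rw [colWeight_smul t hb] at h2
    exact absurd h1 (not_le.2 h2)

theorem columnModule_hom_ext {A : Type*} [AddCommGroup A] [Module ℂ A]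
    {f g : ColumnModule lam m →ₗ[ℂ] A} (h : ∀ t, f (colTabloid t) = g (colTabloid t)) : f = g :=
  Submodule.linearMap_qext _ (Finsupp.lhom_ext' fun t => LinearMap.ext_ring (h t))

theorem span_colTabloid_sup_relations :
    Submodule.span ℂ (Set.range fun t : {t : Tableau lam m // IsStandard t} => colTabloid t.1) ⊔
      relations lam m = ⊤ := by
  by_contra hne
  obtain ⟨g, hg0, hg⟩ := Submodule.exists_le_ker_of_lt_top _ (lt_top_iff_ne_top.2 hne)
  refine hg0 (columnModule_hom_ext fun t => ?_)
  refine eq_zero_of_standard (le_sup_right.trans hg) (fun s hs => ?_) t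
  exact hg (Submodule.mem_sup_left (Submodule.subset_span ⟨⟨s, hs⟩, rfl⟩))

/-! ### The map from column tabloids to polytabloids -/

/-- The linear map `M̃^lam → M^lam` that sends `[t]` to the polytabloid of `t`. -/
noncomputable def polytabloidMap (lam : YoungDiagram) (m : ℕ) :
    ColumnModule lam m →ₗ[ℂ] (RowTabloid lam m →₀ ℂ) :=
  (antisymmetry lam m).liftQ (Finsupp.linearCombination ℂ polytabloid) <| by
    refine Submodule.span_le.2 ?_
    rintro _ ⟨t, b, hb, rfl⟩
    show Finsupp.linearCombination ℂ polytabloid _ = 0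
    rw [map_sub, map_smul, Finsupp.linearCombination_single, Finsupp.linearCombination_single,
      one_smul, one_smul, sub_eq_zero]
    exact polytabloid_smul t b hb

theorem polytabloidMap_colTabloid (t : Tableau lam m) :
    polytabloidMap lam m (colTabloid t) = polytabloid t := by
  show Finsupp.linearCombination ℂ polytabloid (Finsupp.single t 1) = _
  rw [Finsupp.linearCombination_single, one_smul]

theorem span_colTabloid :
    Submodule.span ℂ (Set.range (colTabloid (lam := lam) (m := m))) = ⊤ := by
  rw [← Submodule.ker_mkQ (Submodule.span ℂ (Set.range (colTabloid (lam := lam) (m := m)))),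
    LinearMap.ker_eq_top]
  refine columnModule_hom_ext fun t => ?_
  exact (Submodule.Quotient.mk_eq_zero _).2 (Submodule.subset_span ⟨t, rfl⟩)

theorem polytabloidMap_columnRep (s : Equiv.Perm (Fin m)) (v : ColumnModule lam m) :
    polytabloidMap lam m (columnRep lam m s v) =
      permRep m (RowTabloid lam m) s (polytabloidMap lam m v) := by
  suffices h : polytabloidMap lam m ∘ₗ columnRep lam m s =
      permRep m (RowTabloid lam m) s ∘ₗ polytabloidMap lam m from LinearMap.congr_fun h v
  refine columnModule_hom_ext fun t => ?_
  simp only [LinearMap.comp_apply, columnRep_colTabloid, polytabloidMap_colTabloid,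
    permRep_polytabloid]

theorem range_polytabloidMap : LinearMap.range (polytabloidMap lam m) = spechtModule lam m := by
  rw [LinearMap.range_eq_map, ← span_colTabloid, Submodule.map_span, ← Set.range_comp]
  congr 2
  ext1 t
  exact polytabloidMap_colTabloid t

/-- Modulo the relations every column tabloid is a combination of standard ones, and the polytabloids
of those are linearly independent. -/
theorem ker_polytabloidMap : LinearMap.ker (polytabloidMap lam m) = relations lam m := by
  have hle : relations lam m ≤ LinearMap.ker (polytabloidMap lam m) := by
    refine Submodule.span_le.2 ?_
    rintro _ ⟨t, -, c, -, rfl⟩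
    show polytabloidMap lam m (hMap lam m c (colTabloid t)) = 0
    rw [hMap_colTabloid]
    simp only [etaTableau, exchangeSum, map_sum, map_sub, polytabloidMap_colTabloid]
    exact Finset.sum_eq_zero fun y hy => sub_eq_zero.2 (polytabloid_eq_sum_exchange hy t)
  refine le_antisymm (fun v hv => ?_) hle
  have hmem : v ∈ Submodule.span ℂ (Set.range fun t : {t : Tableau lam m // IsStandard t} =>
      colTabloid t.1) ⊔ relations lam m := by
    rw [span_colTabloid_sup_relations]
    trivial
  obtain ⟨a, ha, r, hr, rfl⟩ := Submodule.mem_sup.1 hmem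
  obtain ⟨l, rfl⟩ := (Finsupp.mem_span_range_iff_exists_finsupp).1 ha
  rw [LinearMap.mem_ker, map_add, LinearMap.mem_ker.1 (hle hr), add_zero, Finsupp.sum,
    map_sum] at hv
  simp only [map_smul, polytabloidMap_colTabloid] at hv
  have hl : l = 0 := (linearIndependent_iff.1 linearIndependent_polytabloid) l hv
  rw [hl, Finsupp.sum_zero_index, zero_add]
  exact hr

end SpechtPresentation

open SpechtPresentation in
theorem theorem2p5 (m : ℕ) (lam : YoungDiagram) (hlam : lam.card = m) :
    ∃ e : (SpechtPresentation.quotientRep lam m).Equiv (SpechtPresentation.spechtRep lam m),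
      ∀ t : SpechtPresentation.Tableau lam m,
        ((e ((SpechtPresentation.relations lam m).mkQ (SpechtPresentation.colTabloid t)) :
          SpechtPresentation.spechtModule lam m) : SpechtPresentation.RowTabloid lam m →₀ ℂ) =
        SpechtPresentation.polytabloid t := by
  let e : (ColumnModule lam m ⧸ relations lam m) ≃ₗ[ℂ] spechtModule lam m :=
    (Submodule.quotEquivOfEq _ _ ker_polytabloidMap.symm).trans
      ((polytabloidMap lam m).quotKerEquivRange.trans
        (LinearEquiv.ofEq _ _ range_polytabloidMap))
  have he : ∀ v, ((e ((relations lam m).mkQ v) : spechtModule lam m) : RowTabloid lam m →₀ ℂ) =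
      polytabloidMap lam m v := fun _ => rfl
  refine ⟨Representation.Equiv.mk e fun s => LinearMap.ext fun w => ?_,
    fun t => (he _).trans (polytabloidMap_colTabloid t)⟩
  obtain ⟨v, rfl⟩ := (relations lam m).mkQ_surjective w
  exact Subtype.ext (polytabloidMap_columnRep s v)
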